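/- Let $n\ge 2$, let $X_1,\dots,X_n$ be independent (not necessarily identically distributed) random variables on a probability space $(\Omega,\mathcal F,\mathbb P)$ with values in a measurable space $(E,\mathcal E)$ and marginal laws $P_1^\star,\dots,P_n^\star$, and let $P^\star=\frac1n\sum_{i=1}^n P_i^\star$. Let $\mathcal C\subset\mathcal E$ be a VC class, i.e. a class of measurable sets whose VC dimension $V$ (the largest cardinality of a finite set shattered by $\mathcal C$) is finite. Assume that $\mathcal C$ is measurable in the following sense: for all $N\ge0$, all $k_1,\dots,k_N\in\{1,\dots,n\}$ and all $J\subset\{1,\dots,N\}$, the set $$\{(y_1,\dots,y_N)\in E^N:\ \text{there is } C\in\mathcal C \text{ with } \{j: y_j\in C\}=J\}$$ is measurable with respect to the completion of $P^\star_{k_1}\otimes\dots\otimes P^\star_{k_N}$ (this holds in particular if $\mathcal C$ is countable, or if there is a countable $\mathcal C_0\subset\mathcal C$ such that the indicator of every $C\in\mathcal C$ is a pointwise limit of indicators of sets of $\mathcal C_0$). Put $$\Gamma=\log(\lceil\log_2 n\rceil)+\log\Bigl(2\sum_{j=0}^{\min(V,n)}\binom nj\Bigr).$$ Then for every $x>0$,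 with probability at least $1-2e^{-x}$, the following inequality holds simultaneously for all $C\in\mathcal C$: $$\frac1n\Bigl|\sum_{i=1}^n\bigl(1_C(X_i)-P_i^\star(C)\bigr)\Bigr|\le\max\Bigl(29\sqrt{P^\star(C)}\sqrt{\frac{\Gamma+x}{n}},\ 20\,\frac{\Gamma+x}{n}\Bigr).$$ That is, the set $\Omega_x$ of outcomes on which it holds for all $C \in \mathcal C$ contains an event of probability at least $1-2e^{-x}$ (so $\mathbb P(\Omega_x)\ge1-2e^{-x}$ if $\Omega_x$ is itself an event). -/

import Mathlib

open MeasureTheory ProbabilityTheory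

namespace VCBernstein

/-- The class `𝒞` shatters the finite set `S`: every subset of `S` is of the form `C ∩ S` with
`C ∈ 𝒞`. -/
def Shatters {E : Type*} (𝒞 : Set (Set E)) (S : Finset E) : Prop :=
  ∀ T : Set E, T ⊆ (S : Set E) → ∃ C ∈ 𝒞, C ∩ (S : Set E) = T

/-- The Vapnik-Chervonenkis dimension: the supremum of the cardinalities of the finite sets
shattered by `𝒞`. -/
noncomputable def vcDim {E : Type*} (𝒞 : Set (Set E)) : ℕ∞ :=
  ⨆ (S : Finset E) (_ : Shatters 𝒞 S), (S.card : ℕ∞)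

/-- Measurability of the class `𝒞` with respect to `P 0, …, P (n - 1)`: for independent points
`y 0, …, y (N - 1)`, each drawn from one of the `P i`, and for every set `J` of indices, the set of
samples in which some member of `𝒞` picks out exactly the points `y j`, `j ∈ J`, is measurable for
the completion of their joint law. -/
def TraceMeasurable {E : Type*} [MeasurableSpace E] {n : ℕ} (𝒞 : Set (Set E))
    (P : Fin n → Measure E) : Prop :=
  ∀ (N : ℕ) (k : Fin N → Fin n) (J : Set (Fin N)),
    NullMeasurableSet {y : Fin N → E | ∃ C ∈ 𝒞, ∀ j, y j ∈ C ↔ j ∈ J}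
      (Measure.pi fun j => P (k j))

/-- The mixture `(1 / n) ∑ i, P i`. -/
noncomputable def mixture {E : Type*} [MeasurableSpace E] {n : ℕ} (P : Fin n → Measure E) :
    Measure E :=
  (n : ENNReal)⁻¹ • ∑ i, P i

/-- `Γ = log ⌈log₂ n⌉ + log (2 ∑_{j = 0}^{V ∧ n} binom(n, j))`, meaningful for `2 ≤ n`. -/
noncomputable def Gam (V n : ℕ) : ℝ :=
  Real.log (⌈Real.logb 2 (n : ℝ)⌉ : ℝ)
    + Real.log (2 * ∑ j ∈ Finset.range (min V n + 1), (n.choose j : ℝ))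

/-- The event on which the Bernstein bound at level `x` holds simultaneously for all `C ∈ 𝒞`, for
the observations `X i` with marginals `P i`. -/
noncomputable def bernsteinEvent {Ω E : Type*} [MeasurableSpace E] {n : ℕ} (𝒞 : Set (Set E))
    (V : ℕ) (P : Fin n → Measure E) (X : Fin n → Ω → E) (x : ℝ) : Set Ω :=
  {ω | ∀ C ∈ 𝒞,
    1 / (n : ℝ) * |∑ i, (C.indicator (fun _ => (1 : ℝ)) (X i ω) - (P i).real C)|
      ≤ max (29 * √((mixture P).real C) * √((Gam V n + x) / n)) (20 * ((Gam V n + x) / n))}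

end VCBernstein

namespace VCBernstein

/-! ### Traces of a class on a finite sample -/

/-! Symmetrization by a ghost sample. Put `K = Γ + x`, `p = ∑ P i (C)`, and let `a`, `b` count the
points in `C` of the sample and of an independent copy. If `a` violates the bound for some `C`, then
with probability at least 1/2 the copy has `|b - p| < √(2p + K)` (`half_le_measure_count_near`),
which forces `4K(a + b) < (a - b)²` (`relative_deviation`). So failure costs at most twice the
probability of `ghostEvent`. That event is estimated by averaging over random exchanges of
coordinates, which preserve the joint law. For a fixed pair of samples, only the pair of traces of
`C` matters. Sauer-Shelah allows at most `S²` pairs, `S` being the binomial sum in `Γ`, and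
Hoeffding gives `2exp(-2K)` for each (`card_swap_le`, `measure_ghostEvent_le`). The total
`4S²exp(-2K)` is at most `exp(-2x)`; only `Γ ≥ log (2S)` enters. -/

open Classical in
/-- The index sets picked out by the class `𝒞` from the sample `y`. -/
noncomputable def traces {E ι : Type*} [Fintype ι] (𝒞 : Set (Set E)) (y : ι → E) :
    Finset (Finset ι) :=
  {J | ∃ C ∈ 𝒞, ∀ i, y i ∈ C ↔ i ∈ J}

lemma mem_traces {E ι : Type*} [Fintype ι] {𝒞 : Set (Set E)} {y : ι → E} {J : Finset ι} :
    J ∈ traces 𝒞 y ↔ ∃ C ∈ 𝒞, ∀ i, y i ∈ C ↔ i ∈ J := by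
  simp [traces]

open Classical in
lemma filter_mem_traces {E ι : Type*} [Fintype ι] {𝒞 : Set (Set E)} {C : Set E} (hC : C ∈ 𝒞)
    (y : ι → E) : Finset.univ.filter (fun i => y i ∈ C) ∈ traces 𝒞 y :=
  mem_traces.2 ⟨C, hC, by simp⟩

/-- An index set shattered by the traces yields a shattered set of the same cardinality. -/
lemma card_le_vcDim_of_shatters_traces {E ι : Type*} [Fintype ι] [DecidableEq ι]
    {𝒞 : Set (Set E)} {y : ι → E} {s : Finset ι} (hs : (traces 𝒞 y).Shatters s) :
    (s.card : ℕ∞) ≤ vcDim 𝒞 := by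
  classical
  -- A trace cannot separate two indices carrying the same point, so a shattered index set has no
  -- repetitions.
  have hinj : Set.InjOn y s := by
    intro i hi j hj hij
    obtain ⟨u, hu, hsu⟩ := hs (t := {i}) (by simpa using hi)
    obtain ⟨C, -, hC⟩ := mem_traces.1 hu
    have hiu : i ∈ s ∩ u := by simp [hsu]
    have hju : j ∈ s ∩ u := by
      refine Finset.mem_inter.2 ⟨hj, ?_⟩
      rw [← hC, ← hij, hC]
      exact (Finset.mem_inter.1 hiu).2
    rw [hsu, Finset.mem_singleton] at hju
    exact hju.symm
  have hsh : Shatters 𝒞 (s.image y) := by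
    intro T hT
    obtain ⟨u, hu, hsu⟩ := hs (t := s.filter (fun i => y i ∈ T)) (Finset.filter_subset _ _)
    obtain ⟨C, hC𝒞, hC⟩ := mem_traces.1 hu
    have key : ∀ i ∈ s, (y i ∈ C ↔ y i ∈ T) := by
      intro i hi
      have : i ∈ s ∩ u ↔ i ∈ s.filter (fun i => y i ∈ T) := by rw [hsu]
      simpa [hi, ← hC] using this
    refine ⟨C, hC𝒞, Set.ext fun z => ⟨?_, fun hz => ?_⟩⟩
    · rintro ⟨hzC, hz⟩
      obtain ⟨i, hi, rfl⟩ := Finset.mem_image.1 (Finset.mem_coe.1 hz)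
      exact (key i hi).1 hzC
    · obtain ⟨i, hi, rfl⟩ := Finset.mem_image.1 (Finset.mem_coe.1 (hT hz))
      exact ⟨(key i hi).2 hz, hT hz⟩
  rw [← Finset.card_image_of_injOn hinj]
  exact le_iSup₂ (f := fun (S : Finset E) (_ : Shatters 𝒞 S) => (S.card : ℕ∞)) _ hsh

/-- The Sauer-Shelah bound for the number of traces on `n` points. -/
lemma card_traces_le {E : Type*} {n V : ℕ} {𝒞 : Set (Set E)} (hV : vcDim 𝒞 = (V : ℕ∞))
    (y : Fin n → E) :
    (traces 𝒞 y).card ≤ ∑ j ∈ Finset.range (min V n + 1), n.choose j := by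
  refine (Finset.card_le_card_shatterer _).trans (Finset.card_shatterer_le_sum_vcDim.trans ?_)
  rw [Fintype.card_fin]
  refine Finset.sum_le_sum_of_subset fun k hk => ?_
  have hd : (traces 𝒞 y).vcDim ≤ min V n := by
    refine Finset.sup_le fun s hs => le_min ?_ (by simpa using Finset.card_le_univ s)
    have := card_le_vcDim_of_shatters_traces (Finset.mem_shatterer.1 hs)
    rw [hV] at this
    exact_mod_cast this
  simp only [Finset.mem_Iic, Finset.mem_range] at hk ⊢
  omega

/-! ### Hoeffding's inequality for random signs -/

/-- The sign attached to a Boolean. -/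
def sgn (b : Bool) : ℝ := if b then -1 else 1

/-- The sum over signs factorizes into terms `2 cosh (θ dᵢ)`, and `cosh t ≤ exp (t² / 2)`. -/
lemma sum_exp_sgn_le {n : ℕ} (d : Fin n → ℝ) (θ : ℝ) :
    ∑ σ : Fin n → Bool, Real.exp (θ * ∑ i, sgn (σ i) * d i)
      ≤ 2 ^ n * Real.exp (θ ^ 2 * (∑ i, d i ^ 2) / 2) := by
  have h1 : ∑ σ : Fin n → Bool, Real.exp (θ * ∑ i, sgn (σ i) * d i)
      = ∏ i, (2 * Real.cosh (θ * d i)) := by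
    have := Finset.prod_univ_sum (fun _ : Fin n => (Finset.univ : Finset Bool))
      (fun i b => Real.exp (θ * (sgn b * d i)))
    rw [Fintype.piFinset_univ] at this
    simp_rw [Finset.mul_sum, Real.exp_sum]
    rw [← this]
    refine Finset.prod_congr rfl fun i _ => ?_
    simp [sgn, Real.cosh_eq]
    ring
  rw [h1, Finset.prod_mul_distrib]
  simp only [Finset.prod_const, Finset.card_univ, Fintype.card_fin]
  gcongr
  calc ∏ i, Real.cosh (θ * d i) ≤ ∏ i, Real.exp ((θ * d i) ^ 2 / 2) :=
        Finset.prod_le_prod (fun i _ => (Real.cosh_pos _).le)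
          fun i _ => Real.cosh_le_exp_half_sq _
    _ = Real.exp (θ ^ 2 * (∑ i, d i ^ 2) / 2) := by
        rw [← Real.exp_sum, Finset.mul_sum, Finset.sum_div]
        simp_rw [mul_pow]

open Classical in
lemma card_signs_le {n : ℕ} (d : Fin n → ℝ) {m K : ℝ} (hd : ∑ i, d i ^ 2 ≤ m) (hK : 0 ≤ K) :
    ((Finset.univ.filter fun σ : Fin n → Bool =>
        4 * K * m < (∑ i, sgn (σ i) * d i) ^ 2).card : ℝ)
      ≤ 2 ^ n * (2 * Real.exp (-(2 * K))) := by
  have hm : 0 ≤ m := (Finset.sum_nonneg fun i _ => sq_nonneg (d i)).trans hd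
  rcases hm.eq_or_lt with rfl | hm
  · have h0 : ∀ i, d i = 0 := fun i => by
      have := (Finset.sum_eq_zero_iff_of_nonneg (fun i _ => sq_nonneg (d i))).1
        (hd.antisymm (Finset.sum_nonneg fun i _ => sq_nonneg (d i))) i (Finset.mem_univ i)
      simpa using this
    simp only [h0, mul_zero, Finset.sum_const_zero, ne_eq, OfNat.ofNat_ne_zero, not_false_eq_true,
      zero_pow, lt_self_iff_false, Finset.filter_false, Finset.card_empty, Nat.cast_zero]
    positivity
  set u := √(4 * K * m) with hu
  have hu0 : 0 ≤ u := Real.sqrt_nonneg _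
  have hu2 : u ^ 2 = 4 * K * m := Real.sq_sqrt (by positivity)
  -- The optimal Chernoff parameter: it minimizes `θ² m / 2 - θ u`, with value `2K - 4K = -2K`.
  set θ := u / m with hθ
  have hθ0 : 0 ≤ θ := by positivity
  have hθu : θ * u = 4 * K := by rw [hθ]; field_simp; linarith
  have hθm : θ ^ 2 * m / 2 = 2 * K := by rw [hθ]; field_simp; linarith
  have hside : ∀ τ : ℝ, τ ^ 2 = θ ^ 2 →
      ∑ σ : Fin n → Bool, Real.exp (τ * ∑ i, sgn (σ i) * d i) ≤ 2 ^ n * Real.exp (2 * K) := by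
    intro τ hτ
    refine (sum_exp_sgn_le d τ).trans ?_
    gcongr
    rw [hτ, ← hθm]
    gcongr
  have hcard : ((Finset.univ.filter fun σ : Fin n → Bool =>
        4 * K * m < (∑ i, sgn (σ i) * d i) ^ 2).card : ℝ) * Real.exp (4 * K)
      ≤ 2 ^ n * Real.exp (2 * K) + 2 ^ n * Real.exp (2 * K) := by
    refine le_trans ?_ (add_le_add (hside θ rfl) (hside (-θ) (by ring)))
    rw [← Finset.sum_add_distrib, ← nsmul_eq_mul, ← Finset.sum_const]
    refine (Finset.sum_le_sum fun σ hσ => ?_).trans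
      (Finset.sum_le_sum_of_subset_of_nonneg (Finset.filter_subset _ _) fun σ _ _ => by positivity)
    have hσ := (Finset.mem_filter.1 hσ).2
    rw [← hu2, sq_lt_sq, abs_of_nonneg hu0] at hσ
    rcases lt_abs.1 hσ with h | h
    · have : Real.exp (4 * K) ≤ Real.exp (θ * ∑ i, sgn (σ i) * d i) := by
        rw [← hθu]; gcongr
      linarith [Real.exp_pos (-θ * ∑ i, sgn (σ i) * d i)]
    · have : Real.exp (4 * K) ≤ Real.exp (-θ * ∑ i, sgn (σ i) * d i) := by
        rw [← hθu, neg_mul, ← mul_neg]; gcongr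
      linarith [Real.exp_pos (θ * ∑ i, sgn (σ i) * d i)]
  have he : Real.exp (2 * K) = Real.exp (-(2 * K)) * Real.exp (4 * K) := by
    rw [← Real.exp_add]; ring_nf
  rw [he] at hcard
  exact le_of_mul_le_mul_right (by linarith) (Real.exp_pos (4 * K))

/-! ### Symmetrization by a ghost sample -/

/-- Exchange the coordinates `i` with `σ i = true` between two samples. -/
def swapSample {E : Type*} {n : ℕ} (σ : Fin n → Bool) (z : (Fin n → E) × (Fin n → E)) :
    (Fin n → E) × (Fin n → E) :=
  (fun i => if σ i then z.2 i else z.1 i, fun i => if σ i then z.1 i else z.2 i)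

/-- Regrouped as a product of the laws `P i ⊗ P i`, the exchange acts on each factor separately, by
the swap or the identity. -/
lemma measurePreserving_swapSample {E : Type*} [MeasurableSpace E] {n : ℕ}
    (P : Fin n → Measure E) [∀ i, IsProbabilityMeasure (P i)] (σ : Fin n → Bool) :
    MeasurePreserving (swapSample σ) ((Measure.pi P).prod (Measure.pi P))
      ((Measure.pi P).prod (Measure.pi P)) := by
  have he := measurePreserving_arrowProdEquivProdArrow E E (Fin n) P P
  have hs : ∀ i, MeasurePreserving (fun w : E × E => if σ i then w.swap else w)
      ((P i).prod (P i)) ((P i).prod (P i)) := by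
    intro i
    by_cases h : σ i
    · simpa [h] using Measure.measurePreserving_swap
    · simpa [h] using! MeasurePreserving.id _
  have := he.comp ((measurePreserving_pi _ _ hs).comp (he.symm _))
  convert this using 1
  funext z
  refine Prod.ext (funext fun i => ?_) (funext fun i => ?_) <;>
    by_cases h : σ i <;>
    simp [swapSample, MeasurableEquiv.arrowProdEquivProdArrow, Equiv.arrowProdEquivProdArrow, h]

/-- Lets `TraceMeasurable`, applied to `2n` points, speak about pairs of samples. -/
lemma measurePreserving_append {E : Type*} [MeasurableSpace E] {n : ℕ}
    (P : Fin n → Measure E) [∀ i, IsProbabilityMeasure (P i)] :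
    MeasurePreserving (fun z : (Fin n → E) × (Fin n → E) => Fin.append z.1 z.2)
      ((Measure.pi P).prod (Measure.pi P)) (Measure.pi fun j => P (Fin.append id id j)) := by
  have hm : Measurable (fun z : (Fin n → E) × (Fin n → E) => Fin.append z.1 z.2) := by
    refine measurable_pi_lambda _ fun j => ?_
    refine Fin.addCases (fun i => ?_) (fun i => ?_) j
    · simp only [Fin.append_left]; fun_prop
    · simp only [Fin.append_right]; fun_prop
  refine ⟨hm, (Measure.pi_eq fun s hs => ?_).symm⟩
  have hpre : (fun z : (Fin n → E) × (Fin n → E) => Fin.append z.1 z.2) ⁻¹' Set.univ.pi s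
      = (Set.univ.pi fun i => s (Fin.castAdd n i)) ×ˢ (Set.univ.pi fun i => s (Fin.natAdd n i)) := by
    ext z
    simp only [Set.mem_preimage, Set.mem_pi, Set.mem_univ, true_implies, Set.mem_prod]
    refine ⟨fun h => ⟨fun i => by simpa using h (Fin.castAdd n i),
      fun i => by simpa [-Fin.natAdd_eq_addNat] using h (Fin.natAdd n i)⟩, fun h j => ?_⟩
    refine Fin.addCases (fun i => ?_) (fun i => ?_) j
    · simpa using h.1 i
    · simpa [-Fin.natAdd_eq_addNat] using h.2 i
  rw [Measure.map_apply hm (MeasurableSet.univ_pi hs), hpre, Measure.prod_prod, Measure.pi_pi,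
    Measure.pi_pi, Fin.prod_univ_add]
  simp [-Fin.natAdd_eq_addNat]

/-- The number of points of the sample `y` in `C`. -/
noncomputable def count {E : Type*} {n : ℕ} (C : Set E) (y : Fin n → E) : ℝ :=
  ∑ i, C.indicator (fun _ => (1 : ℝ)) (y i)

/-- Pairs of samples on which the empirical measures of some `C ∈ 𝒞` differ by more than the
relative deviation allowed at level `K`. -/
def ghostEvent {E : Type*} (𝒞 : Set (Set E)) (n : ℕ) (K : ℝ) : Set ((Fin n → E) × (Fin n → E)) :=
  {z | ∃ C ∈ 𝒞, 4 * K * (count C z.1 + count C z.2) < (count C z.1 - count C z.2) ^ 2}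

open Classical in
lemma count_eq_card_of_trace {E : Type*} {n : ℕ} {C : Set E} {y : Fin n → E} {J : Finset (Fin n)}
    (h : ∀ i, y i ∈ C ↔ i ∈ J) : count C y = J.card := by
  simp [count, Set.indicator_apply, h]

/-- The counts depend on `C` only through its trace on the joined sample, so the event is a finite
union of trace events. -/
lemma nullMeasurableSet_ghostEvent {E : Type*} [MeasurableSpace E] {n : ℕ} {𝒞 : Set (Set E)}
    (P : Fin n → Measure E) [∀ i, IsProbabilityMeasure (P i)] (h : TraceMeasurable 𝒞 P) (K : ℝ) :
    NullMeasurableSet (ghostEvent 𝒞 n K) ((Measure.pi P).prod (Measure.pi P)) := by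
  classical
  have heq : ghostEvent 𝒞 n K = ⋃ q ∈ {q : Finset (Fin n) × Finset (Fin n) |
      4 * K * ((q.1.card : ℝ) + q.2.card) < ((q.1.card : ℝ) - q.2.card) ^ 2},
      (fun z : (Fin n → E) × (Fin n → E) => Fin.append z.1 z.2) ⁻¹'
        {y | ∃ C ∈ 𝒞, ∀ j, y j ∈ C ↔ j ∈ {j : Fin (n + n) |
          Fin.addCases (motive := fun _ => Prop) (· ∈ q.1) (· ∈ q.2) j}} := by
    ext z
    simp only [ghostEvent, Set.mem_ofPred_eq, Set.mem_iUnion, Set.mem_preimage, exists_prop]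
    constructor
    · rintro ⟨C, hC, hz⟩
      refine ⟨(Finset.univ.filter fun i => z.1 i ∈ C, Finset.univ.filter fun i => z.2 i ∈ C),
        ?_, C, hC, fun j => ?_⟩
      · rwa [count_eq_card_of_trace (y := z.1) (J := Finset.univ.filter fun i => z.1 i ∈ C) (by simp),
          count_eq_card_of_trace (y := z.2) (J := Finset.univ.filter fun i => z.2 i ∈ C)
            (by simp)] at hz
      · refine Fin.addCases (fun i => ?_) (fun i => ?_) j <;> simp [-Fin.natAdd_eq_addNat]
    · rintro ⟨q, hq, C, hC, hz⟩
      refine ⟨C, hC, ?_⟩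
      rwa [count_eq_card_of_trace (y := z.1) (J := q.1)
          (fun i => by simpa using hz (Fin.castAdd n i)),
        count_eq_card_of_trace (y := z.2) (J := q.2)
          (fun i => by simpa [-Fin.natAdd_eq_addNat] using hz (Fin.natAdd n i))]
  rw [heq]
  exact NullMeasurableSet.biUnion (Set.to_countable _) fun q _ =>
    (h (n + n) (Fin.append id id) _).preimage (measurePreserving_append P).quasiMeasurePreserving

-- An exchange leaves the sum of the two counts unchanged and turns their difference into a signed
-- sum of `d i ∈ {-1, 0, 1}`. A union bound over pairs of traces then reduces to `card_signs_le`.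
open Classical in
lemma card_swap_le {E : Type*} {n V : ℕ} {𝒞 : Set (Set E)} (hV : vcDim 𝒞 = (V : ℕ∞))
    {K : ℝ} (hK : 0 ≤ K) (z : (Fin n → E) × (Fin n → E)) :
    ((Finset.univ.filter fun σ : Fin n → Bool => swapSample σ z ∈ ghostEvent 𝒞 n K).card : ℝ)
      ≤ (∑ j ∈ Finset.range (min V n + 1), (n.choose j : ℝ)) ^ 2
        * (2 ^ n * (2 * Real.exp (-(2 * K)))) := by
  let d : Finset (Fin n) × Finset (Fin n) → Fin n → ℝ := fun q i =>
    (if i ∈ q.1 then 1 else 0) - (if i ∈ q.2 then 1 else 0)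
  let m : Finset (Fin n) × Finset (Fin n) → ℝ := fun q =>
    ∑ i, ((if i ∈ q.1 then 1 else 0) + (if i ∈ q.2 then 1 else 0))
  have hdm : ∀ q, ∑ i, d q i ^ 2 ≤ m q := fun q => by
    refine Finset.sum_le_sum fun i _ => ?_
    simp only [d]
    split_ifs <;> norm_num
  have hsub : (Finset.univ.filter fun σ : Fin n → Bool => swapSample σ z ∈ ghostEvent 𝒞 n K)
      ⊆ (traces 𝒞 z.1 ×ˢ traces 𝒞 z.2).biUnion fun q =>
        Finset.univ.filter fun σ : Fin n → Bool =>
          4 * K * m q < (∑ i, sgn (σ i) * d q i) ^ 2 := by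
    intro σ hσ
    obtain ⟨C, hC, h⟩ := (Finset.mem_filter.1 hσ).2
    refine Finset.mem_biUnion.2 ⟨(Finset.univ.filter fun i => z.1 i ∈ C,
      Finset.univ.filter fun i => z.2 i ∈ C), Finset.mem_product.2
        ⟨filter_mem_traces hC _, filter_mem_traces hC _⟩, Finset.mem_filter.2
        ⟨Finset.mem_univ _, ?_⟩⟩
    convert h using 2
    · rw [count, count, ← Finset.sum_add_distrib]
      refine Finset.sum_congr rfl fun i _ => ?_
      by_cases hi : σ i <;> simp [swapSample, hi, Set.indicator_apply, add_comm]
    · rw [count, count, ← Finset.sum_sub_distrib]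
      refine Finset.sum_congr rfl fun i _ => ?_
      by_cases hi : σ i <;> simp [swapSample, hi, Set.indicator_apply, sgn, d]
  have htr : ∀ y : Fin n → E, ((traces 𝒞 y).card : ℝ)
      ≤ ∑ j ∈ Finset.range (min V n + 1), (n.choose j : ℝ) := fun y => by
    exact_mod_cast card_traces_le hV y
  calc ((Finset.univ.filter fun σ : Fin n → Bool => swapSample σ z ∈ ghostEvent 𝒞 n K).card : ℝ)
      ≤ ∑ q ∈ traces 𝒞 z.1 ×ˢ traces 𝒞 z.2,
        ((Finset.univ.filter fun σ : Fin n → Bool =>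
          4 * K * m q < (∑ i, sgn (σ i) * d q i) ^ 2).card : ℝ) := by
        exact_mod_cast (Finset.card_le_card hsub).trans Finset.card_biUnion_le
    _ ≤ ∑ q ∈ traces 𝒞 z.1 ×ˢ traces 𝒞 z.2, 2 ^ n * (2 * Real.exp (-(2 * K))) :=
        Finset.sum_le_sum fun q _ => card_signs_le (d q) (hdm q) hK
    _ = ((traces 𝒞 z.1).card : ℝ) * (traces 𝒞 z.2).card
          * (2 ^ n * (2 * Real.exp (-(2 * K)))) := by
        rw [Finset.sum_const, Finset.card_product, nsmul_eq_mul, Nat.cast_mul]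
    _ ≤ _ := by
        rw [sq]
        gcongr
        · exact htr _
        · exact htr _

/-- By invariance the measure equals its average over all exchanges, and `card_swap_le` bounds that
average pointwise. -/
lemma measure_ghostEvent_le {E : Type*} [MeasurableSpace E] {n V : ℕ} {𝒞 : Set (Set E)}
    (P : Fin n → Measure E) [∀ i, IsProbabilityMeasure (P i)] (h : TraceMeasurable 𝒞 P)
    (hV : vcDim 𝒞 = (V : ℕ∞)) {K : ℝ} (hK : 0 ≤ K) :
    ((Measure.pi P).prod (Measure.pi P)).real (ghostEvent 𝒞 n K)
      ≤ (∑ j ∈ Finset.range (min V n + 1), (n.choose j : ℝ)) ^ 2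
        * (2 * Real.exp (-(2 * K))) := by
  classical
  set μ := (Measure.pi P).prod (Measure.pi P)
  set W := ghostEvent 𝒞 n K
  have hW : NullMeasurableSet W μ := nullMeasurableSet_ghostEvent P h K
  have hT := measurePreserving_swapSample P
  have hWσ : ∀ σ, NullMeasurableSet (swapSample σ ⁻¹' W) μ := fun σ =>
    hW.preimage (hT σ).quasiMeasurePreserving
  have hint : ∀ σ, Integrable ((swapSample σ ⁻¹' W).indicator fun _ => (1 : ℝ)) μ := fun σ =>
    (integrable_const (1 : ℝ)).indicator₀ (hWσ σ)
  have h1 : ∀ σ : Fin n → Bool, μ.real W = ∫ z, (swapSample σ ⁻¹' W).indicator (fun _ => (1 : ℝ)) z ∂μ := by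
    intro σ
    rw [integral_indicator₀ (hWσ σ), setIntegral_const, smul_eq_mul, mul_one, measureReal_def,
      measureReal_def, (hT σ).measure_preimage hW]
  have h2 : (2 : ℝ) ^ n * μ.real W = ∫ z, ∑ σ : Fin n → Bool,
      (swapSample σ ⁻¹' W).indicator (fun _ => (1 : ℝ)) z ∂μ := by
    rw [integral_finsetSum _ fun σ _ => hint σ, ← Finset.sum_congr rfl fun σ _ => h1 σ]
    simp
  have h3 : (2 : ℝ) ^ n * μ.real W ≤ (∑ j ∈ Finset.range (min V n + 1), (n.choose j : ℝ)) ^ 2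
        * (2 ^ n * (2 * Real.exp (-(2 * K)))) := by
    rw [h2]
    refine (integral_mono (g := fun _ => _) (integrable_finsetSum _ fun σ _ => hint σ)
      (integrable_const _) fun z => le_trans (le_of_eq ?_) (card_swap_le hV hK z)).trans_eq
        (by simp [μ])
    simp [Set.indicator_apply, W]
  have h4 : (0 : ℝ) < 2 ^ n := by positivity
  exact le_of_mul_le_mul_left (h3.trans_eq (by ring)) h4

/-! ### The ghost sample stays close to its mean -/

/-- Chebyshev: the variance is at most `p`, half of `2p`. The extra `K` keeps the threshold positive
when `p = 0`. -/
lemma half_le_measure_count_near {E : Type*} [MeasurableSpace E] {n : ℕ} (P : Fin n → Measure E)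
    [∀ i, IsProbabilityMeasure (P i)] {C : Set E} (hC : MeasurableSet C) {K : ℝ} (hK : 0 < K) :
    (2 : ENNReal)⁻¹ ≤ Measure.pi P {y | |count C y - ∑ i, (P i).real C|
      < √(2 * (∑ i, (P i).real C) + K)} := by
  set μ := Measure.pi P
  set p := ∑ i, (P i).real C
  have hp : 0 ≤ p := Finset.sum_nonneg fun i _ => measureReal_nonneg
  let Y : Fin n → (Fin n → E) → ℝ := fun i y => C.indicator (fun _ => (1 : ℝ)) (y i)
  have hind : Measurable (C.indicator fun _ => (1 : ℝ)) := measurable_const.indicator hC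
  have hYm : ∀ i, Measurable (Y i) := fun i => hind.comp (measurable_pi_apply i)
  have hY2 : ∀ i, MemLp (Y i) 2 μ := fun i =>
    MemLp.of_bound (hYm i).aestronglyMeasurable 1 (Filter.Eventually.of_forall fun y => by
      by_cases h : y i ∈ C <;> simp [Y, h])
  have hYsum : (fun y => count C y) = ∑ i, Y i := by
    funext y; simp [count, Y]
  have hYint : ∀ i, ∫ y, Y i y ∂μ = (P i).real C := fun i => by
    have h := integral_map (μ := μ) (measurable_pi_apply i).aemeasurable
      (f := C.indicator fun _ => (1 : ℝ)) hind.aestronglyMeasurable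
    rw [(measurePreserving_eval P i).map_eq, integral_indicator_const _ hC, smul_eq_mul,
      mul_one] at h
    exact h.symm
  have hmean : ∫ y, count C y ∂μ = p := by
    simp only [count]
    rw [integral_finsetSum _ fun i _ => (hY2 i).integrable (by norm_num)]
    exact Finset.sum_congr rfl fun i _ => hYint i
  have hindep : iIndepFun Y μ := iIndepFun_pi fun i => hind.aemeasurable
  have hvar : variance (fun y => count C y) μ ≤ p := by
    rw [hYsum, IndepFun.variance_sum (fun i _ => hY2 i)
      fun i _ j _ hij => hindep.indepFun hij]
    refine Finset.sum_le_sum fun i _ => ?_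
    refine (variance_le_expectation_sq (hYm i).aestronglyMeasurable).trans_eq ?_
    rw [← hYint i]
    congr 1
    funext y
    by_cases h : y i ∈ C <;> simp [Y, h]
  have hs : 0 < √(2 * p + K) := Real.sqrt_pos.2 (by linarith)
  have hcount : MemLp (fun y => count C y) 2 μ := by
    rw [hYsum]; exact memLp_finsetSum' _ fun i _ => hY2 i
  have hcheb := meas_ge_le_variance_div_sq hcount hs
  rw [hmean, Real.sq_sqrt (by linarith)] at hcheb
  have hle : ENNReal.ofReal (variance (fun y => count C y) μ / (2 * p + K)) ≤ (2 : ENNReal)⁻¹ := by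
    rw [show (2 : ENNReal)⁻¹ = ENNReal.ofReal 2⁻¹ by
      rw [ENNReal.ofReal_inv_of_pos two_pos]; simp]
    refine ENNReal.ofReal_le_ofReal ?_
    rw [div_le_iff₀ (by linarith)]
    linarith
  have hmeas : MeasurableSet {y : Fin n → E | √(2 * p + K) ≤ |count C y - p|} := by
    refine measurableSet_le measurable_const ?_
    have : Measurable fun y : Fin n → E => count C y :=
      Finset.measurable_sum _ fun i _ => hYm i
    fun_prop
  have hcompl : {y | |count C y - p| < √(2 * p + K)}
      = {y : Fin n → E | √(2 * p + K) ≤ |count C y - p|}ᶜ := by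
    ext y; simp
  rw [hcompl, prob_compl_eq_one_sub hmeas, ← ENNReal.one_sub_inv_two]
  exact tsub_le_tsub_left (hcheb.trans hle) 1

/-! ### The main estimate -/

/-- If `a` deviates from `p` beyond the Bernstein bound and `b` is close to `p`, then `a` and `b`
are far apart relative to `a + b`. -/
lemma relative_deviation {a b p K : ℝ} (hp : 0 ≤ p) (hK : 1 ≤ K)
    (ha : max (29 * √(p * K)) (20 * K) < |a - p|) (hbp : |b - p| < √(2 * p + K)) :
    4 * K * (a + b) < (a - b) ^ 2 := by
  set s := √(2 * p + K)
  set r := √(p * K)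
  set D := |a - b|
  have hs2 : s ^ 2 = 2 * p + K := Real.sq_sqrt (by linarith)
  have hr2 : r ^ 2 = p * K := Real.sq_sqrt (by positivity)
  have hs0 : 0 ≤ s := Real.sqrt_nonneg _
  have hr0 : 0 ≤ r := Real.sqrt_nonneg _
  have h1 := (le_max_left _ _).trans_lt ha
  have h2 := (le_max_right _ _).trans_lt ha
  have hD : |a - p| ≤ D + |b - p| := by
    simpa using abs_add_le (a - b) (b - p)
  have hab : a + b ≤ D + 2 * (p + s) := by
    have := le_abs_self (a - b)
    have := le_abs_self (b - p)
    linarith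
  -- `s` is at most `2 r + K`
  have hsr : s ≤ 2 * r + K := by
    refine Real.sqrt_le_iff.2 ⟨by linarith, ?_⟩
    nlinarith [mul_nonneg hp (by linarith : (0:ℝ) ≤ K - 1)]
  have hD1 : 29 * r < D + s := by linarith
  have hD2 : 20 * K < D + s := by linarith
  rw [← sq_abs (a - b)]
  have hD0 : 0 ≤ D := abs_nonneg _
  -- Eliminating `s` gives `D > 27r - K` and `D > 19K - 2r`; positive combinations of these yield
  -- both bounds.
  have hDK : 17 * K ≤ D := by nlinarith
  have hDr : 17 * r ≤ D := by nlinarith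
  have hpK : p * K ≤ (D / 17) ^ 2 := by rw [← hr2]; gcongr; linarith
  -- With `K` and `r` at most `D / 17`, `4K(D + 2p + 2s)` is at most `(4/17 + 32/289) D² = (100/289)
  -- D²`.
  nlinarith [mul_le_mul_of_nonneg_left hab (by linarith : (0:ℝ) ≤ 4 * K),
    mul_le_mul_of_nonneg_left hDK hD0, mul_le_mul_of_nonneg_left hDK hs0,
    mul_le_mul_of_nonneg_left hsr (by linarith : (0:ℝ) ≤ K)]

lemma one_le_sauer (V n : ℕ) :
    (1 : ℝ) ≤ ∑ j ∈ Finset.range (min V n + 1), (n.choose j : ℝ) := by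
  rw [Finset.sum_range_succ']
  simp only [Nat.choose_zero_right, Nat.cast_one, le_add_iff_nonneg_left]
  positivity

lemma log_le_Gam (V : ℕ) {n : ℕ} (hn : 2 ≤ n) :
    Real.log (2 * ∑ j ∈ Finset.range (min V n + 1), (n.choose j : ℝ)) ≤ Gam V n := by
  have h1 : (1 : ℤ) ≤ ⌈Real.logb 2 (n : ℝ)⌉ := by
    rw [Int.one_le_ceil_iff]
    exact Real.logb_pos one_lt_two (by exact_mod_cast hn)
  exact le_add_of_nonneg_left (Real.log_nonneg (by exact_mod_cast h1))

/-- The confidence level in terms of `Gam`: four times the squared Sauer sum is absorbed by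
`exp (2 * (Gam V n + x))`. -/
lemma four_mul_sauer_sq_mul_exp_le {V n : ℕ} (hn : 2 ≤ n) {x : ℝ} (hx : 0 ≤ x) :
    2 * ((∑ j ∈ Finset.range (min V n + 1), (n.choose j : ℝ)) ^ 2
        * (2 * Real.exp (-(2 * (Gam V n + x))))) ≤ 2 * Real.exp (-x) := by
  set S := ∑ j ∈ Finset.range (min V n + 1), (n.choose j : ℝ)
  have hS : 1 ≤ S := one_le_sauer V n
  have hG : Real.log (2 * S) ≤ Gam V n := log_le_Gam V hn
  have h1 : 2 * S * Real.exp (-(Gam V n + x)) ≤ Real.exp (-x) := by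
    calc 2 * S * Real.exp (-(Gam V n + x))
        ≤ Real.exp (Gam V n) * Real.exp (-(Gam V n + x)) := by
          gcongr
          exact (Real.log_le_iff_le_exp (by linarith)).1 hG
      _ = Real.exp (-x) := by rw [← Real.exp_add]; ring_nf
  have h2 : Real.exp (-x) ≤ 1 := Real.exp_le_one_iff.2 (by linarith)
  have h3 : Real.exp (-(2 * (Gam V n + x))) = Real.exp (-(Gam V n + x)) ^ 2 := by
    rw [← Real.exp_nat_mul]; ring_nf
  have h0 : 0 ≤ 2 * S * Real.exp (-(Gam V n + x)) := by positivity
  have h4 := Real.exp_pos (-x)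
  rw [h3]
  nlinarith [mul_le_mul h1 h1 h0 h4.le]

lemma not_mem_bernsteinEvent {Ω E : Type*} [MeasurableSpace E] {n : ℕ} (hn : 0 < n)
    {𝒞 : Set (Set E)} {V : ℕ} {P : Fin n → Measure E} [∀ i, IsProbabilityMeasure (P i)]
    {X : Fin n → Ω → E} {x : ℝ} {ω : Ω} (h : ω ∉ bernsteinEvent 𝒞 V P X x) :
    ∃ C ∈ 𝒞, max (29 * √((∑ i, (P i).real C) * (Gam V n + x))) (20 * (Gam V n + x))
      < |count C (fun i => X i ω) - ∑ i, (P i).real C| := by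
  simp only [bernsteinEvent, Set.mem_ofPred_eq, not_forall, not_le] at h
  obtain ⟨C, hC, h⟩ := h
  refine ⟨C, hC, ?_⟩
  have hn' : (0 : ℝ) < n := by exact_mod_cast hn
  set p := ∑ i, (P i).real C with hp
  have hp0 : 0 ≤ p := Finset.sum_nonneg fun i _ => measureReal_nonneg
  have hmix : (mixture P).real C = p / n := by
    have hsum : (∑ i, P i).real C = p := by
      simp [hp, measureReal_def, Measure.finsetSum_apply, ENNReal.toReal_sum]
    rw [mixture, measureReal_ennreal_smul_apply, hsum, ENNReal.toReal_inv,
      ENNReal.toReal_natCast, inv_mul_eq_div]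
  rw [Finset.sum_sub_distrib, hmix, mul_assoc, ← Real.sqrt_mul (by positivity),
    show p / n * ((Gam V n + x) / n) = p * (Gam V n + x) / (n : ℝ) ^ 2 by field_simp,
    Real.sqrt_div' _ (by positivity), Real.sqrt_sq hn'.le, ← mul_div_assoc, ← mul_div_assoc,
    max_div_div_right hn'.le, div_lt_iff₀ hn'] at h
  refine h.trans_eq ?_
  rw [count, ← hp]
  field_simp

end VCBernstein

open VCBernstein in
theorem mainTheorem10 {Ω E : Type*} [MeasurableSpace Ω] [MeasurableSpace E]
    (ν : Measure Ω) [IsProbabilityMeasure ν]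
    (n : ℕ) (hn : 2 ≤ n)
    (X : Fin n → Ω → E) (hX : ∀ i, Measurable (X i)) (hindep : iIndepFun X ν)
    (𝒞 : Set (Set E)) (h𝒞 : ∀ C ∈ 𝒞, MeasurableSet C)
    (V : ℕ) (hV : VCBernstein.vcDim 𝒞 = (V : ℕ∞))
    (htrace : VCBernstein.TraceMeasurable 𝒞 (fun i => ν.map (X i)))
    (x : ℝ) (hx : 0 < x) :
    ∃ A : Set Ω, MeasurableSet A ∧
      A ⊆ VCBernstein.bernsteinEvent 𝒞 V (fun i => ν.map (X i)) X x ∧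
      1 - 2 * Real.exp (-x) ≤ ν.real A := by
  rcases lt_or_ge x (Real.log 2) with hx2 | hx2
  · -- the bound on the probability is vacuous
    refine ⟨∅, MeasurableSet.empty, Set.empty_subset _, ?_⟩
    have : Real.exp (-Real.log 2) ≤ Real.exp (-x) := Real.exp_le_exp.2 (by linarith)
    rw [Real.exp_neg, Real.exp_log two_pos] at this
    rw [measureReal_empty]
    linarith
  set P : Fin n → Measure E := fun i => ν.map (X i) with hP
  have hprob : ∀ i, IsProbabilityMeasure (P i) := fun i =>
    Measure.isProbabilityMeasure_map (hX i).aemeasurable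
  set μ := Measure.pi P
  set K := Gam V n + x with hK
  have hK1 : 1 ≤ K := by
    -- `Γ` and `x` each contribute at least `log 2 > 1/2`.
    have h1 : Real.log 2 ≤ Gam V n :=
      (Real.log_le_log two_pos (by linarith [one_le_sauer V n])).trans (log_le_Gam V hn)
    linarith [Real.log_two_gt_d9]
  set W := ghostEvent 𝒞 n K
  -- `W` is only null-measurable; its measurable hull has the same measure and measurable fibre
  -- masses.
  set W' := toMeasurable (μ.prod μ) W
  have hW' : MeasurableSet W' := measurableSet_toMeasurable _ _
  let B : Set (Fin n → E) := {y | (2 : ENNReal)⁻¹ ≤ μ (Prod.mk y ⁻¹' W')}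
  have hBm : MeasurableSet B :=
    measurableSet_le measurable_const (measurable_measure_prodMk_left hW')
  have hB : μ.real B ≤ 2 * Real.exp (-x) := by
    refine le_trans ?_ (four_mul_sauer_sq_mul_exp_le (V := V) hn hx.le)
    refine le_trans ?_ (mul_le_mul_of_nonneg_left
      (measure_ghostEvent_le P htrace hV (by linarith : 0 ≤ K)) zero_le_two)
    -- Markov's inequality for the fibre mass. `B` contains every sample violating the bound, so its
    -- complement gives the required event.
    have h1 : (2 : ENNReal)⁻¹ * μ B ≤ (μ.prod μ) W := by
      rw [← measure_toMeasurable W, Measure.prod_apply hW']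
      exact mul_meas_ge_le_lintegral (measurable_measure_prodMk_left hW') _
    have h2 := ENNReal.toReal_mono (measure_ne_top _ _) h1
    rw [ENNReal.toReal_mul, ENNReal.toReal_inv] at h2
    simp only [ENNReal.toReal_ofNat] at h2
    simp only [measureReal_def]
    linarith
  have hXm : Measurable fun ω i => X i ω := measurable_pi_lambda _ hX
  have hmap : ν.map (fun ω i => X i ω) = μ :=
    (iIndepFun_iff_map_fun_eq_pi_map fun i => (hX i).aemeasurable).1 hindep
  refine ⟨(fun ω i => X i ω) ⁻¹' Bᶜ, hXm hBm.compl, fun ω hω => ?_, ?_⟩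
  · by_contra hbad
    obtain ⟨C, hC, hdev⟩ := not_mem_bernsteinEvent (by omega) hbad
    refine hω ((half_le_measure_count_near P (h𝒞 C hC) (by linarith : 0 < K)).trans
      (measure_mono fun y hy => subset_toMeasurable _ _ ⟨C, hC, ?_⟩))
    exact relative_deviation (Finset.sum_nonneg fun i _ => measureReal_nonneg) hK1 hdev hy
  · rw [← map_measureReal_apply hXm hBm.compl, hmap, probReal_compl_eq_one_sub hBm]
    linarith
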